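/- There is an absolute constant $C>0$ such that the following holds. Let $d\ge 1$, and let $F$ be a symmetric probability distribution on $\mathbb{R}^d$ (that is, $F\{-A\}=F\{A\}$ for every Borel set $A$) with $\operatorname{supp} F\subset\mathbb{Z}^d$ and $q:=F\{\vec 0\}\in(0,1)$. For $y>0$ put $$\delta(y)=\sum_{\vec x\in\mathbb{Z}^d\setminus\{\vec 0\}}\min\bigl(1,\; y\,e\,F\{\vec x\}\bigr),$$ let $I$ be the unit mass at $\vec 0$, let $\exp\{M\}=\sum_{j\ge 0}M^{*j}/j!$ (with $M^{*0}=I$) for a finite signed measure $M$ on $\mathbb{R}^d$, where $M^{*j}$ are convolution powers, and let $d(G,H)=\sup_B|G\{B\}-H\{B\}|$, the supremum being over all Borel sets $B\subset\mathbb{R}^d$, denote the total variation distance. Then, for every integer $n\ge 1$, $$d\bigl(F^{*n},\exp\{n(F-I)\}\bigr)\le\frac{C\,\bigl(1+\delta^2(n)\bigr)}{n\,q^{7/2}}.$$ The constant $C$ does not depend on $d$, $F$, $q$ or $n$. -/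

import Mathlib

open MeasureTheory

namespace CompoundPoisson

noncomputable section

/-- Convolution of finite signed measures: the image of the product signed measure
(the one with mass `M s * V t` on every measurable rectangle `s ×ˢ t`) under addition. -/
def conv {E : Type*} [AddCommMonoid E] [MeasurableSpace E] (M V : SignedMeasure E) :
    SignedMeasure E :=
  (VectorMeasure.prod M V (ContinuousLinearMap.mul ℝ ℝ)).map (fun x : E × E => x.1 + x.2)

/-- The unit mass `I` at the origin. -/
def unitMass (E : Type*) [AddCommMonoid E] [MeasurableSpace E] : SignedMeasure E :=
  (Measure.dirac (0 : E)).toSignedMeasure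

/-- Convolution powers `M^{*n}`, with `M^{*0} = I`. -/
def convPow {E : Type*} [AddCommMonoid E] [MeasurableSpace E] (M : SignedMeasure E) :
    ℕ → SignedMeasure E
  | 0 => unitMass E
  | n + 1 => conv (convPow M n) M

theorem isFiniteMeasure_variation {E : Type*} [MeasurableSpace E] (M : SignedMeasure E) :
    IsFiniteMeasure M.variation := by
  rw [← SignedMeasure.totalVariation_eq_variation]
  infer_instance

theorem variation_conv_univ_le {E : Type*} [AddCommMonoid E] [MeasurableSpace E]
    (M V : SignedMeasure E) :
    (conv M V).variation Set.univ ≤ M.variation Set.univ * V.variation Set.univ := by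
  have := isFiniteMeasure_variation M
  have := isFiniteMeasure_variation V
  by_cases hm : Measurable (fun x : E × E => x.1 + x.2)
  · calc (conv M V).variation Set.univ
        ≤ ((VectorMeasure.prod M V (ContinuousLinearMap.mul ℝ ℝ)).variation.map
            (fun x : E × E => x.1 + x.2)) Set.univ :=
          VectorMeasure.variation_map_le Set.univ
      _ = (VectorMeasure.prod M V (ContinuousLinearMap.mul ℝ ℝ)).variation Set.univ := by
          rw [Measure.map_apply hm MeasurableSet.univ, Set.preimage_univ]
      _ ≤ (‖ContinuousLinearMap.mul ℝ ℝ‖ₑ • M.variation.prod V.variation) Set.univ :=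
          VectorMeasure.variation_prod_le Set.univ
      _ = M.variation Set.univ * V.variation Set.univ := by
          rw [Measure.smul_apply, ← Set.univ_prod_univ, Measure.prod_prod]
          simp [enorm_eq_nnnorm, nnnorm, ContinuousLinearMap.opNorm_mul]
  · have : conv M V = 0 := by simp [conv, VectorMeasure.map, hm]
    simp [this]

theorem variation_convPow_univ_le {E : Type*} [AddCommMonoid E] [MeasurableSpace E]
    (M : SignedMeasure E) (n : ℕ) :
    (convPow M n).variation Set.univ ≤ M.variation Set.univ ^ n := by
  induction n with
  | zero => simp [convPow, unitMass]
  | succ n ih =>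
    rw [pow_succ]
    exact (variation_conv_univ_le _ _).trans (by gcongr)

theorem norm_convPow_apply_le {E : Type*} [AddCommMonoid E] [MeasurableSpace E]
    (M : SignedMeasure E) (n : ℕ) (A : Set E) :
    ‖convPow M n A‖ ≤ M.variation.real Set.univ ^ n := by
  have := isFiniteMeasure_variation M
  have := isFiniteMeasure_variation (convPow M n)
  calc ‖convPow M n A‖ ≤ (convPow M n).variation.real A := VectorMeasure.norm_measure_le_variation
    _ ≤ (convPow M n).variation.real Set.univ := measureReal_mono (Set.subset_univ A)
    _ ≤ (M.variation Set.univ ^ n).toReal :=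
        ENNReal.toReal_mono (by finiteness) (variation_convPow_univ_le M n)
    _ = M.variation.real Set.univ ^ n := by rw [ENNReal.toReal_pow, measureReal_def]

theorem summable_convExp {E : Type*} [AddCommMonoid E] [MeasurableSpace E]
    (M : SignedMeasure E) (A : Set E) :
    Summable (fun j : ℕ => convPow M j A / (j.factorial : ℝ)) := by
  refine Summable.of_norm_bounded
    (Real.summable_pow_div_factorial (M.variation.real Set.univ)) (fun j => ?_)
  rw [norm_div, Real.norm_natCast]
  gcongr
  exact norm_convPow_apply_le M j A

/-- The exponential measure `exp{M} = ∑_{j ≥ 0} M^{*j} / j!`. -/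
def convExp {E : Type*} [AddCommMonoid E] [MeasurableSpace E] (M : SignedMeasure E) :
    SignedMeasure E where
  measureOf' A := ∑' j : ℕ, convPow M j A / (j.factorial : ℝ)
  empty' := by simp
  not_measurable' A hA := by simp [VectorMeasure.not_measurable _ hA]
  m_iUnion' f hf hd := by
    have key : ∀ s : Finset ℕ, ∑ i ∈ s, ∑' j : ℕ, convPow M j (f i) / (j.factorial : ℝ)
        = ∑' j : ℕ, (∑ i ∈ s, convPow M j (f i)) / (j.factorial : ℝ) := by
      intro s
      rw [← Summable.tsum_finsetSum (fun i _ => summable_convExp M (f i))]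
      simp_rw [Finset.sum_div]
    simp only [HasSum, SummationFilter.unconditional_filter]
    simp_rw [key]
    refine tendsto_tsum_of_dominated_convergence
      (Real.summable_pow_div_factorial (M.variation.real Set.univ)) (fun j => ?_)
      (Filter.Eventually.of_forall fun s j => ?_)
    · exact Filter.Tendsto.div_const
        (VectorMeasure.hasSum_of_disjoint_iUnion hf hd) _
    · rw [norm_div, Real.norm_natCast]
      gcongr
      rw [← VectorMeasure.of_biUnion_finset (fun i _ k _ hik => hd hik) (fun i _ => hf i)]
      exact norm_convPow_apply_le M j _

/-- Total variation distance `sup_B |F{B} - G{B}|` over measurable sets `B`.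
(The set of values is bounded, since signed measures are finite.) -/
def tvDist {E : Type*} [MeasurableSpace E] (F G : SignedMeasure E) : ℝ :=
  sSup {r : ℝ | ∃ B : Set E, MeasurableSet B ∧ r = |F B - G B|}

/-- The point of `ℝ^d` with the given integer coordinates. -/
def latticePoint {d : ℕ} (x : Fin d → ℤ) : EuclideanSpace ℝ (Fin d) :=
  WithLp.toLp 2 (fun i => (x i : ℝ))

/-- `δ(y) = ∑_{x ∈ ℤ^d \ {0}} min(1, y e F{x})`. -/
def delta {d : ℕ} (F : Measure (EuclideanSpace ℝ (Fin d))) (y : ℝ) : ℝ :=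
  ∑' x : {x : Fin d → ℤ // x ≠ 0}, min 1 (y * Real.exp 1 * F.real {latticePoint x.1})

end

end CompoundPoisson

open CompoundPoisson

/-! Let `T` be convolution by F on bounded functions on ℤ^d, an average of commuting shifts with
weights `p x`. The distance is at most the operator norm of T^n - exp(n(T-1)). Here exp(n(T-1)) is
the mean of T^J for J Poisson with mean n. Expand T^J about J = n: the linear term has mean zero,
and the remainder is governed by (T-1)²T^m (`norm_exp_smul_sub_one_sub_pow_le`). It therefore
suffices that this operator has norm O(δ²/(q²(m+1)²)) for m ≤ n, and halving m reduces this to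
‖(T-1)T^m‖ = O(δ/(q(m+1))).

By symmetry 2(T-1) is the sum of p_x(e_x + e_{-x} - 2). Since F has mass q at 0 and p_x at ±x, T
contains w = 2 q p_x times the lazy walk U = (e_x + e_{-x} + 2)/4. A second difference is smoothed
by U^j to size 4/(j+1), and T^m uses U about mw times, so its smoothed second difference is O(1/(m q
p_x)). The factor p_x cancels: each x contributes O(1/(qm)), and trivially O(p_x). The smaller of
the two, summed over x, gives δ. The result has q^{-2}, stronger than q^{-7/2}. -/

/-! ### Smoothing of differences by binomial averages -/

section BinomialSmoothing

-- This is the variance of a fair binomial variable, read off from the Bernstein polynomials at 1/2.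
open Polynomial in
theorem sum_choose_mul_two_mul_sub_sq (M : ℕ) :
    ∑ k ∈ Finset.range (M + 1), (M.choose k : ℝ) * (2 * (k : ℝ) - M) ^ 2 = (2 : ℝ) ^ M * M := by
  have h := congrArg (Polynomial.eval (1 / 2 : ℝ)) (bernsteinPolynomial.variance ℝ M)
  simp only [bernsteinPolynomial, nsmul_eq_mul, eval_finsetSum, eval_mul, eval_pow, eval_sub,
    eval_natCast, eval_X, eval_one] at h
  have h2 : (2 : ℝ) ^ M * (4 * ∑ k ∈ Finset.range (M + 1), (M * (1 / 2 : ℝ) - k) ^ 2 *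
      (M.choose k * (1 / 2) ^ k * (1 - 1 / 2) ^ (M - k))) = 2 ^ M * M := by
    rw [h]; ring
  rw [← h2, Finset.mul_sum, Finset.mul_sum]
  refine Finset.sum_congr rfl fun k hk => ?_
  have hk' : k + (M - k) = M := by have := Finset.mem_range.1 hk; omega
  have e : (2 : ℝ) ^ M * ((1 / 2) ^ k * (1 - 1 / 2) ^ (M - k)) = 1 := by
    rw [show (1 - 1 / 2 : ℝ) = 1 / 2 by norm_num, ← pow_add, hk', ← mul_pow]; norm_num
  linear_combination (-(M.choose k : ℝ) * (2 * k - M) ^ 2) * e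

theorem sum_choose_mul_abs_le (M : ℕ) :
    ∑ k ∈ Finset.range (M + 1), (M.choose k : ℝ) * |2 * (k : ℝ) - M| ≤ 2 ^ M * √M := by
  have hs : ∑ k ∈ Finset.range (M + 1), (M.choose k : ℝ) = 2 ^ M := by
    exact_mod_cast Nat.sum_range_choose M
  have h := Finset.sum_mul_sq_le_sq_mul_sq (Finset.range (M + 1))
    (fun k => √(M.choose k : ℝ)) (fun k => √(M.choose k : ℝ) * |2 * (k : ℝ) - M|)
  simp only [← mul_assoc, Real.mul_self_sqrt (Nat.cast_nonneg _), mul_pow,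
    Real.sq_sqrt (Nat.cast_nonneg _), sq_abs, sum_choose_mul_two_mul_sub_sq, hs] at h
  refine abs_le_of_sq_le_sq' ?_ (by positivity) |>.2
  rw [mul_pow, Real.sq_sqrt (Nat.cast_nonneg _)]
  linarith

-- With P = (1+X)^(N+1), both sides equal 2XP' - (N+1)P. The coefficients become binomial weights
-- times centred deviations.
open Polynomial in
theorem Polynomial.sub_one_mul_one_add_pow (N : ℕ) :
    ((N + 1 : ℕ) : ℝ) • ((X - 1) * (1 + X) ^ N : ℝ[X]) =
      ∑ k ∈ Finset.range (N + 1 + 1), ((N + 1).choose k * (2 * k - (N + 1 : ℕ)) : ℝ) • X ^ k := by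
  have h0 : (1 + X : ℝ[X]) ^ (N + 1) =
      ∑ k ∈ Finset.range (N + 1 + 1), ((N + 1).choose k : ℝ) • X ^ k := by
    rw [add_comm, add_pow]
    refine Finset.sum_congr rfl fun k _ => ?_
    rw [one_pow, mul_one, mul_comm, smul_eq_C_mul, C_eq_natCast]
  have h1 : X * derivative ((1 + X : ℝ[X]) ^ (N + 1)) =
      ∑ k ∈ Finset.range (N + 1 + 1), ((N + 1).choose k * k : ℝ) • X ^ k := by
    rw [h0, derivative_sum, Finset.mul_sum]
    refine Finset.sum_congr rfl fun k _ => ?_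
    rcases k with _ | k
    · simp
    · rw [Polynomial.derivative_smul, derivative_X_pow, smul_eq_C_mul, smul_eq_C_mul,
        Nat.add_sub_cancel, C_mul, pow_succ]
      ring
  have h2 : X * derivative ((1 + X : ℝ[X]) ^ (N + 1)) =
      ((N + 1 : ℕ) : ℝ) • (X * (1 + X) ^ N) := by
    rw [derivative_pow, smul_eq_C_mul]; simp; ring
  have h3 : ((N + 1 : ℕ) : ℝ) • ((X - 1) * (1 + X) ^ N : ℝ[X]) =
      (2 : ℝ) • (X * derivative ((1 + X : ℝ[X]) ^ (N + 1)))
        - ((N + 1 : ℕ) : ℝ) • (1 + X) ^ (N + 1) := by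
    rw [h2]; simp only [smul_eq_C_mul, map_ofNat]; ring
  rw [h3, h1, h0, Finset.smul_sum, Finset.smul_sum, ← Finset.sum_sub_distrib]
  refine Finset.sum_congr rfl fun k _ => ?_
  rw [smul_smul, smul_smul, ← sub_smul]
  congr 1; ring

variable {A : Type*} [NormedRing A] [NormedAlgebra ℝ A]

/-- For power-bounded `s` the norm is at most the sum of the absolute coefficients, which is a mean
absolute deviation. This gains 1/√(N+1) over the trivial 2^(N+1). -/
theorem norm_sub_one_mul_one_add_pow_le {s : A} (hs : ∀ k : ℕ, ‖s ^ k‖ ≤ 1) (N : ℕ) :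
    ‖(s - 1) * (1 + s) ^ N‖ ≤ 2 ^ (N + 1) / √(N + 1 : ℕ) := by
  have h := congrArg (Polynomial.aeval s) (Polynomial.sub_one_mul_one_add_pow N)
  simp only [map_smul, map_mul, map_sub, map_pow, map_add, map_one, Polynomial.aeval_X,
    map_sum] at h
  have hN : (0 : ℝ) < (N + 1 : ℕ) := by positivity
  have h1 : ((N + 1 : ℕ) : ℝ) * ‖(s - 1) * (1 + s) ^ N‖ ≤ 2 ^ (N + 1) * √(N + 1 : ℕ) := by
    calc ((N + 1 : ℕ) : ℝ) * ‖(s - 1) * (1 + s) ^ N‖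
        = ‖((N + 1 : ℕ) : ℝ) • ((s - 1) * (1 + s) ^ N)‖ := by
          rw [norm_smul, Real.norm_natCast]
      _ ≤ ∑ k ∈ Finset.range (N + 1 + 1),
            ((N + 1).choose k : ℝ) * |2 * (k : ℝ) - (N + 1 : ℕ)| := by
          rw [h]
          refine norm_sum_le_of_le _ fun k _ => ?_
          rw [norm_smul, norm_mul, Real.norm_natCast, Real.norm_eq_abs]
          exact mul_le_of_le_one_right (by positivity) (hs k)
      _ ≤ _ := sum_choose_mul_abs_le (N + 1)
  rw [le_div_iff₀ (by positivity)]
  have h2 : √((N + 1 : ℕ) : ℝ) * √((N + 1 : ℕ) : ℝ) = (N + 1 : ℕ) := Real.mul_self_sqrt hN.le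
  have h3 : 0 < √((N + 1 : ℕ) : ℝ) := Real.sqrt_pos.2 hN
  refine le_of_mul_le_mul_left ?_ h3
  calc √((N + 1 : ℕ) : ℝ) * (‖(s - 1) * (1 + s) ^ N‖ * √((N + 1 : ℕ) : ℝ))
      = (√((N + 1 : ℕ) : ℝ) * √((N + 1 : ℕ) : ℝ)) * ‖(s - 1) * (1 + s) ^ N‖ := by ring
    _ ≤ √((N + 1 : ℕ) : ℝ) * 2 ^ (N + 1) := by rw [h2]; linarith

/-- With t = s⁻¹, s + t - 2 = t(s-1)² and s + t + 2 = t(1+s)². The product thus contains the square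
of (s-1)(1+s)^j, and two gains of 1/√(j+1) multiply. -/
theorem norm_second_difference_mul_pow_le {s t : A} (hst : s * t = 1) (hts : t * s = 1)
    (hs : ∀ k : ℕ, ‖s ^ k‖ ≤ 1) (ht : ∀ k : ℕ, ‖t ^ k‖ ≤ 1) (j : ℕ) :
    ‖(s + t - 2) * ((4 : ℝ)⁻¹ • (s + t + 2)) ^ j‖ ≤ 4 / (j + 1) := by
  have hc : Commute t s := hts.trans hst.symm
  have e1 : s + t - 2 = t * (s - 1) ^ 2 := by
    have : t * (s - 1) ^ 2 = (t * s) * s - 2 * (t * s) + t := by noncomm_ring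
    rw [this, hts, one_mul, mul_one]; abel
  have e2 : s + t + 2 = t * (1 + s) ^ 2 := by
    have : t * (1 + s) ^ 2 = (t * s) * s + 2 * (t * s) + t := by noncomm_ring
    rw [this, hts, one_mul, mul_one]; abel
  have c1 : Commute t (1 + s) := (Commute.one_right t).add_right hc
  have c2 : Commute t (s - 1) := hc.sub_right (Commute.one_right t)
  have c3 : Commute (s - 1) (1 + s) :=
    ((Commute.one_right _).add_right ((Commute.refl s).sub_left (Commute.one_left s)))
  have e3 : (s + t - 2) * ((4 : ℝ)⁻¹ • (s + t + 2)) ^ j =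
      ((4 : ℝ)⁻¹) ^ j • (t ^ (j + 1) * (((s - 1) * (1 + s) ^ j) * ((s - 1) * (1 + s) ^ j))) := by
    rw [e1, e2, smul_pow, mul_smul_comm]
    congr 1
    rw [(c1.pow_right 2).mul_pow, ← pow_mul, mul_comm 2 j, pow_mul, sq ((1 + s) ^ j), sq (s - 1),
      pow_succ']
    have c4 : (1 + s) ^ j * (s - 1) = (s - 1) * (1 + s) ^ j := (c3.pow_right j).symm
    have c5 : t ^ j * (s - 1) = (s - 1) * t ^ j := c2.pow_left j
    simp only [mul_assoc]
    rw [← mul_assoc ((1 + s) ^ j) (s - 1), c4]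
    rw [← mul_assoc (t ^ j) (s - 1), c5]
    simp only [mul_assoc]
    rw [← mul_assoc (t ^ j) (s - 1), c5]
    simp only [mul_assoc]
  have hb := norm_sub_one_mul_one_add_pow_le hs j
  have hN : (0 : ℝ) < (j + 1 : ℕ) := by positivity
  rw [e3, norm_smul, norm_pow, norm_inv, Real.norm_ofNat]
  calc (4 : ℝ)⁻¹ ^ j * ‖t ^ (j + 1) * (((s - 1) * (1 + s) ^ j) * ((s - 1) * (1 + s) ^ j))‖
      ≤ (4 : ℝ)⁻¹ ^ j * (1 * (2 ^ (j + 1) / √(j + 1 : ℕ) * (2 ^ (j + 1) / √(j + 1 : ℕ)))) := by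
        refine mul_le_mul_of_nonneg_left ?_ (by positivity)
        refine (norm_mul_le _ _).trans (mul_le_mul (ht _) ?_ (norm_nonneg _) zero_le_one)
        exact (norm_mul_le _ _).trans (mul_le_mul hb hb (norm_nonneg _) (by positivity))
    _ = 4 / (j + 1) := by
        rw [one_mul, div_mul_div_comm, Real.mul_self_sqrt hN.le, ← mul_pow, inv_pow]
        norm_num [pow_succ]
        field_simp

/-- Expanding the power leaves the mean of K/(j+1) for j binomial(m, w). As C(m,j)/(j+1) =
C(m+1,j+1)/(m+1), this is K/((m+1)w) times a partial sum of binomial(m+1, w) probabilities. -/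
theorem norm_mul_mixture_pow_le [NormOneClass A] {D U V : A} {w K : ℝ} (hw0 : 0 < w) (hw1 : w ≤ 1)
    (hUV : Commute U V) (hV : ‖V‖ ≤ 1 - w) (hK : 0 ≤ K)
    (hD : ∀ j : ℕ, ‖D * U ^ j‖ ≤ K / (j + 1)) (m : ℕ) :
    ‖D * (w • U + V) ^ m‖ ≤ K / ((m + 1) * w) := by
  have hc : Commute (w • U) V := hUV.smul_left w
  have hV' : ∀ k : ℕ, ‖V ^ k‖ ≤ (1 - w) ^ k := fun k =>
    (norm_pow_le V k).trans (pow_le_pow_left₀ (norm_nonneg _) hV k)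
  have hterm : ∀ j ∈ Finset.range (m + 1),
      ‖D * ((w • U) ^ j * V ^ (m - j) * (m.choose j : A))‖ ≤
        K / ((m + 1) * w) * (w ^ (j + 1) * (1 - w) ^ (m + 1 - (j + 1)) *
          ((m + 1).choose (j + 1) : ℝ)) := by
    intro j _
    have e : D * ((w • U) ^ j * V ^ (m - j) * (m.choose j : A)) =
        ((m.choose j : ℝ) * w ^ j) • ((D * U ^ j) * V ^ (m - j)) := by
      rw [smul_pow, mul_comm (m.choose j : ℝ), mul_smul, ← nsmul_eq_mul', ← Nat.cast_smul_eq_nsmul ℝ]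
      simp only [smul_mul_assoc, mul_smul_comm, mul_assoc]
      rw [smul_comm]
    have hch : ((m + 1).choose (j + 1) : ℝ) * (j + 1) = (m + 1) * m.choose j := by
      exact_mod_cast (Nat.add_one_mul_choose_eq m j).symm
    rw [e, norm_smul, Real.norm_of_nonneg (by positivity), Nat.add_sub_add_right]
    calc (m.choose j : ℝ) * w ^ j * ‖D * U ^ j * V ^ (m - j)‖
        ≤ (m.choose j : ℝ) * w ^ j * (K / (j + 1) * (1 - w) ^ (m - j)) := by
          refine mul_le_mul_of_nonneg_left ((norm_mul_le _ _).trans ?_) (by positivity)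
          exact mul_le_mul (hD j) (hV' _) (norm_nonneg _) (by positivity)
      _ = _ := by
          have : (m.choose j : ℝ) = ((m + 1).choose (j + 1) : ℝ) * (j + 1) / (m + 1) := by
            rw [hch]; field_simp
          rw [this, pow_succ]; field_simp
  have hsum : ∑ j ∈ Finset.range (m + 1), (w ^ (j + 1) * (1 - w) ^ (m + 1 - (j + 1)) *
          ((m + 1).choose (j + 1) : ℝ)) ≤ 1 := by
    have h := add_pow w (1 - w) (m + 1)
    rw [Finset.sum_range_succ', add_sub_cancel, one_pow] at h
    have : 0 ≤ (1 - w) ^ (m + 1 - 0) := pow_nonneg (by linarith) _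
    have h2 : 0 ≤ w ^ 0 * (1 - w) ^ (m + 1 - 0) * ((m + 1).choose 0 : ℝ) := by simpa using this
    linarith
  rw [hc.add_pow, Finset.mul_sum]
  refine (norm_sum_le_of_le _ hterm).trans ?_
  rw [← Finset.mul_sum]
  exact mul_le_of_le_one_right (by positivity) hsum

end BinomialSmoothing

/-! ### Symmetric averages of commuting shifts -/

section ShiftAlgebra

variable {A : Type*} [NormedRing A] [NormedAlgebra ℝ A]

theorem norm_le_of_hasSum_smul {X : Type*} {e : X → A} (he : ∀ x, ‖e x‖ ≤ 1) {r : X → ℝ}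
    (hr : ∀ x, 0 ≤ r x) {c : ℝ} (hc : HasSum r c) {v : A} (hv : HasSum (fun x => r x • e x) v) :
    ‖v‖ ≤ c := by
  refine hv.norm_le_of_bounded hc fun x => ?_
  rw [norm_smul, Real.norm_of_nonneg (hr x)]
  exact mul_le_of_le_one_right (hr x) (he x)

variable {X : Type*} [AddCommGroup X] [NormOneClass A] {e : X → A} {p : X → ℝ} {T : A}

/-- The walk U is split off from `T` with weight proportional to `p x`, so the factor `p x` on the
left cancels and the bound is uniform in `x`. -/
theorem mul_norm_second_difference_mul_pow_le (h0 : e 0 = 1)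
    (hadd : ∀ x y, e (x + y) = e x * e y) (he : ∀ x, ‖e x‖ ≤ 1) (hp : ∀ x, 0 ≤ p x)
    (hp1 : HasSum p 1) (hsymm : ∀ x, p (-x) = p x) (hq : 0 < p 0)
    (hT : HasSum (fun x => p x • e x) T) {x : X} (hx0 : x ≠ 0) (hx : x ≠ -x) (m : ℕ) :
    p x * ‖(e x + e (-x) - 2) * T ^ m‖ ≤ 2 / (p 0 * (m + 1)) := by
  classical
  rcases (hp x).eq_or_lt with hpx | hpx
  · rw [← hpx, zero_mul]; positivity
  have hle : ∀ y, p y ≤ 1 := fun y => le_hasSum hp1 y fun z _ => hp z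
  set w : ℝ := 2 * p 0 * p x with hw
  have hw0 : 0 < w := by positivity
  have hnx0 : -x ≠ 0 := neg_ne_zero.2 hx0
  have hsingle : ∀ (y : X) (c : ℝ), HasSum (fun z => (Pi.single y c : X → ℝ) z • e z) (c • e y) := by
    intro y c
    have := hasSum_single (f := fun z => (Pi.single y c : X → ℝ) z • e z) y
      fun z hz => by simp [hz]
    simpa using this
  -- Weights left after removing wU. They are nonnegative because w/2 = p 0 · p x ≤ p 0 and w/4 = p
  -- 0 · p x / 2 ≤ p x; `x ≠ -x` keeps the two removed masses at separate points.
  let r : X → ℝ := fun z => p z - ((Pi.single 0 (w / 2) : X → ℝ) z +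
    ((Pi.single x (w / 4) : X → ℝ) z + (Pi.single (-x) (w / 4) : X → ℝ) z))
  have hr0 : ∀ z, 0 ≤ r z := by
    intro z
    have h1 := hle 0
    have h2 := hle x
    have h3 : w / 2 ≤ p 0 := by rw [hw]; nlinarith
    have h4 : w / 4 ≤ p x := by rw [hw]; nlinarith
    simp only [r, Pi.single_apply]
    rcases eq_or_ne z 0 with rfl | hz
    · simpa [hx0.symm, hnx0.symm] using h3
    rcases eq_or_ne z x with rfl | hzx
    · simpa [hz, hx] using h4
    rcases eq_or_ne z (-x) with rfl | hzn
    · simpa [hz, hzx, hsymm] using h4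
    simpa [hz, hzx, hzn] using hp z
  have hr1 : HasSum r (1 - w) := by
    have := hp1.sub ((hasSum_pi_single (0 : X) (w / 2)).add
      ((hasSum_pi_single x (w / 4)).add (hasSum_pi_single (-x) (w / 4))))
    rwa [show w / 2 + (w / 4 + w / 4) = w by ring] at this
  set U : A := (4 : ℝ)⁻¹ • (e x + e (-x) + 2) with hU
  have hV : HasSum (fun z => r z • e z) (T - w • U) := by
    have := hT.sub ((hsingle 0 (w / 2)).add ((hsingle x (w / 4)).add (hsingle (-x) (w / 4))))
    simp only [r, sub_smul, add_smul]
    have hv : T - w • U = T - ((w / 2) • e 0 + ((w / 4) • e x + (w / 4) • e (-x))) := by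
      rw [hU, h0, ← one_add_one_eq_two (R := A)]
      module
    rw [hv]
    exact this
  have hw1 : w ≤ 1 := by
    have := hr1.nonneg hr0
    linarith
  have hcomm : ∀ y z, Commute (e y) (e z) := fun y z => by
    rw [Commute, SemiconjBy, ← hadd, ← hadd, add_comm]
  have hUe : ∀ z, Commute U (e z) := fun z =>
    Commute.smul_left (((hcomm _ _).add_left (hcomm _ _)).add_left (Nat.cast_commute 2 _)) _
  have hUV : Commute U (T - w • U) := by
    have h1 := hV.mul_left U
    have h2 := hV.mul_right U
    simp_rw [mul_smul_comm, (hUe _).eq] at h1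
    simp_rw [smul_mul_assoc] at h2
    exact h1.unique h2
  have hpow : ∀ (y : X) (k : ℕ), ‖e y ^ k‖ ≤ 1 := fun y k =>
    (norm_pow_le _ _).trans (pow_le_one₀ (norm_nonneg _) (he y))
  have key := norm_mul_mixture_pow_le (D := e x + e (-x) - 2) (K := 4) hw0 hw1 hUV
    (norm_le_of_hasSum_smul he hr0 hr1 hV) (by norm_num)
    (norm_second_difference_mul_pow_le (by rw [← hadd, add_neg_cancel, h0])
      (by rw [← hadd, neg_add_cancel, h0]) (hpow x) (hpow (-x))) m
  rw [add_sub_cancel] at key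
  calc p x * ‖(e x + e (-x) - 2) * T ^ m‖ ≤ p x * (4 / ((m + 1) * w)) :=
        mul_le_mul_of_nonneg_left key (hp x)
    _ = 2 / (p 0 * (m + 1)) := by rw [hw]; field_simp; norm_num

/-- Pairing x with -x turns T - 1 into second differences. Each is bounded both by the uniform
estimate and by 4 p x, which produces the minimum. Torsion-freeness excludes x = -x. -/
theorem norm_sub_one_mul_pow_le [IsAddTorsionFree X] (h0 : e 0 = 1)
    (hadd : ∀ x y, e (x + y) = e x * e y) (he : ∀ x, ‖e x‖ ≤ 1) (hp : ∀ x, 0 ≤ p x)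
    (hp1 : HasSum p 1) (hsymm : ∀ x, p (-x) = p x) (hq : 0 < p 0)
    (hT : HasSum (fun x => p x • e x) T) {y : ℝ} {m : ℕ} (hy : m + 1 ≤ y) :
    ‖(T - 1) * T ^ m‖ ≤ 2 / (p 0 * (m + 1)) * ∑' x : {x : X // x ≠ 0}, min 1 (y * p x.1) := by
  have hq1 : p 0 ≤ 1 := le_hasSum hp1 0 fun z _ => hp z
  have hm : (0 : ℝ) < m + 1 := by positivity
  have hy0 : 0 ≤ y := hm.le.trans hy
  have hT1 : ‖T‖ ≤ 1 := norm_le_of_hasSum_smul he hp hp1 hT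
  have hone : HasSum (fun x => p x • (1 : A)) 1 := by
    simpa using hp1.smul_const (1 : A)
  have hT' : HasSum (fun x => p x • e (-x)) T := by
    have := (Equiv.neg X).hasSum_iff.2 hT
    simpa [Function.comp_def, hsymm] using this
  have hsum : HasSum (fun x => p x • ((e x + e (-x) - 2) * T ^ m))
      ((2 : ℝ) • ((T - 1) * T ^ m)) := by
    have := ((hT.sub hone).add (hT'.sub hone)).mul_right (T ^ m)
    have hv : (2 : ℝ) • ((T - 1) * T ^ m) = (T - 1 + (T - 1)) * T ^ m := by
      rw [add_mul, two_smul]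
    have hf : ∀ x, p x • ((e x + e (-x) - 2) * T ^ m) =
        (p x • e x - p x • 1 + (p x • e (-x) - p x • 1)) * T ^ m := fun x => by
      rw [← smul_mul_assoc, ← one_add_one_eq_two]
      congr 1
      module
    simp_rw [hv, hf]
    exact this
  have hsub : HasSum (fun x : {x : X // x ≠ 0} => p x.1 • ((e x.1 + e (-x.1) - 2) * T ^ m))
      ((2 : ℝ) • ((T - 1) * T ^ m)) := by
    refine (hasSum_subtype_iff_of_support_subset (s := {x : X | x ≠ 0}) ?_).2 hsum
    intro x hx hx0
    apply hx
    obtain rfl : x = 0 := hx0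
    simp only [neg_zero, h0, one_add_one_eq_two, sub_self, zero_mul, smul_zero]
  have hmin : Summable fun x : {x : X // x ≠ 0} => min 1 (y * p x.1) := by
    refine Summable.of_nonneg_of_le (fun x => le_min zero_le_one (mul_nonneg hy0 (hp _)))
      (fun x => min_le_right _ _) ?_
    exact (hp1.summable.subtype _).mul_left y
  have hb : ∀ x : {x : X // x ≠ 0}, ‖p x.1 • ((e x.1 + e (-x.1) - 2) * T ^ m)‖ ≤
      4 / (p 0 * (m + 1)) * min 1 (y * p x.1) := by
    intro ⟨x, hx⟩
    have hxx : x ≠ -x := fun h => hx (self_eq_neg.1 h)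
    have h1 := mul_norm_second_difference_mul_pow_le h0 hadd he hp hp1 hsymm hq hT hx hxx m
    rw [norm_smul, Real.norm_of_nonneg (hp x), mul_min_of_nonneg _ _ (by positivity), mul_one]
    refine le_min (h1.trans (by gcongr; norm_num)) ?_
    have h2 : ‖(e x + e (-x) - 2) * T ^ m‖ ≤ 4 := by
      have h3 : ‖e x + e (-x) - 2‖ ≤ 4 := by
        have h4 : ‖(2 : A)‖ ≤ 2 := by
          rw [← one_add_one_eq_two]
          refine (norm_add_le _ _).trans ?_
          rw [norm_one]; norm_num
        have h5 := norm_sub_le (e x + e (-x)) 2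
        have h6 := norm_add_le (e x) (e (-x))
        linarith [he x, he (-x)]
      have h7 : ‖T ^ m‖ ≤ 1 := (norm_pow_le _ _).trans (pow_le_one₀ (norm_nonneg _) hT1)
      calc _ ≤ _ := norm_mul_le _ _
        _ ≤ 4 * 1 := mul_le_mul h3 h7 (norm_nonneg _) (by norm_num)
        _ = 4 := mul_one _
    calc p x * ‖(e x + e (-x) - 2) * T ^ m‖ ≤ p x * 4 := mul_le_mul_of_nonneg_left h2 (hp x)
      _ = 4 / (p 0 * (m + 1)) * (p 0 * (m + 1) * p x) := by field_simp
      _ ≤ 4 / (p 0 * (m + 1)) * (1 * y * p x) := by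
          gcongr
          exact hp x
      _ = _ := by rw [one_mul]
  have := hsub.norm_le_of_bounded (hmin.hasSum.mul_left _) hb
  rw [norm_smul, Real.norm_ofNat] at this
  rw [show (2 : ℝ) / (p 0 * (m + 1)) = 4 / (p 0 * (m + 1)) / 2 by ring, div_mul_eq_mul_div]
  linarith

theorem norm_sub_one_sq_mul_pow_le [IsAddTorsionFree X] (h0 : e 0 = 1)
    (hadd : ∀ x y, e (x + y) = e x * e y) (he : ∀ x, ‖e x‖ ≤ 1) (hp : ∀ x, 0 ≤ p x)
    (hp1 : HasSum p 1) (hsymm : ∀ x, p (-x) = p x) (hq : 0 < p 0)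
    (hT : HasSum (fun x => p x • e x) T) {y : ℝ} {m : ℕ} (hy : m + 1 ≤ y) :
    ‖(T - 1) ^ 2 * T ^ m‖ ≤
      16 * (∑' x : {x : X // x ≠ 0}, min 1 (y * p x.1)) ^ 2 / p 0 ^ 2 / (m + 1) ^ 2 := by
  set S := ∑' x : {x : X // x ≠ 0}, min 1 (y * p x.1) with hS
  have hm : (0 : ℝ) < m + 1 := by positivity
  have hS0 : 0 ≤ S := tsum_nonneg fun x =>
    le_min zero_le_one (mul_nonneg (hm.le.trans hy) (hp _))
  -- Either half k of m satisfies m + 1 ≤ 2(k + 1), even for odd m, so halving costs only a factor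
  -- 2.
  have hhalf : ∀ k : ℕ, k ≤ m → m ≤ 2 * k + 1 →
      ‖(T - 1) * T ^ k‖ ≤ 4 * S / (p 0 * (m + 1)) := by
    intro k hk hk2
    have hkm : (k : ℝ) + 1 ≤ y := le_trans (by exact_mod_cast Nat.succ_le_succ hk) hy
    have hk2' : (m : ℝ) + 1 ≤ 2 * (k + 1) := by
      have : (m : ℝ) ≤ 2 * k + 1 := by exact_mod_cast hk2
      linarith
    refine (norm_sub_one_mul_pow_le h0 hadd he hp hp1 hsymm hq hT hkm).trans ?_
    rw [← hS, div_mul_eq_mul_div, div_le_div_iff₀ (by positivity) (by positivity)]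
    have := mul_le_mul_of_nonneg_left hk2' (mul_nonneg (mul_nonneg zero_le_two hS0) hq.le)
    linarith
  have hT1 : Commute (T - 1) T := (Commute.refl T).sub_left (Commute.one_left T)
  have hsplit : (T - 1) ^ 2 * T ^ m = ((T - 1) * T ^ (m / 2)) * ((T - 1) * T ^ (m - m / 2)) := by
    have h1 : T ^ (m / 2) * (T - 1) = (T - 1) * T ^ (m / 2) := (hT1.pow_right _).symm
    have h2 : m / 2 + (m - m / 2) = m := by omega
    rw [mul_assoc, ← mul_assoc (T ^ (m / 2)), h1, mul_assoc (T - 1), ← pow_add, h2, sq, mul_assoc]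
  rw [hsplit]
  refine (norm_mul_le _ _).trans ((mul_le_mul (hhalf _ (by omega) (by omega))
    (hhalf _ (by omega) (by omega)) (norm_nonneg _) (by positivity)).trans_eq ?_)
  field_simp; ring

end ShiftAlgebra

/-! ### Poisson moments and second-order expansion of powers -/

section PoissonMixture

open Nat in
theorem hasSum_pow_div_factorial (c : ℝ) : HasSum (fun j : ℕ => c ^ j / j !) (Real.exp c) := by
  rw [Real.exp_eq_exp_ℝ]
  exact NormedSpace.expSeries_div_hasSum_exp c

open Nat in
theorem hasSum_pow_div_factorial_mul_natCast (c : ℝ) :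
    HasSum (fun j : ℕ => c ^ j / j ! * j) (c * Real.exp c) := by
  have h : HasSum (fun j : ℕ => c ^ (j + 1) / (j + 1)! * (j + 1 : ℕ)) (c * Real.exp c) := by
    refine ((hasSum_pow_div_factorial c).mul_left c).congr_fun fun j => ?_
    rw [Nat.factorial_succ, Nat.cast_mul, _root_.pow_succ']
    field_simp
  simpa using (hasSum_nat_add_iff (f := fun j : ℕ => c ^ j / j ! * j) 1).1 h

open Nat in
theorem hasSum_pow_div_factorial_mul_descending (c : ℝ) :
    HasSum (fun j : ℕ => c ^ j / j ! * (j * (j - 1))) (c ^ 2 * Real.exp c) := by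
  have h : HasSum (fun j : ℕ => c ^ (j + 1) / (j + 1)! * ((j + 1 : ℕ) * ((j + 1 : ℕ) - 1 : ℝ)))
      (c ^ 2 * Real.exp c) := by
    rw [sq, mul_assoc]
    refine ((hasSum_pow_div_factorial_mul_natCast c).mul_left c).congr_fun fun j => ?_
    rw [Nat.factorial_succ, Nat.cast_mul]
    push_cast
    field_simp
    ring
  simpa using (hasSum_nat_add_iff (f := fun j : ℕ => c ^ j / j ! * (j * (j - 1 : ℝ))) 1).1 h

open Nat in
theorem hasSum_pow_div_factorial_mul_sub (c : ℝ) :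
    HasSum (fun j : ℕ => c ^ j / j ! * (j - c)) 0 := by
  have := (hasSum_pow_div_factorial_mul_natCast c).sub ((hasSum_pow_div_factorial c).mul_left c)
  rw [sub_self] at this
  refine this.congr_fun fun j => ?_
  ring

open Nat in
theorem hasSum_pow_div_factorial_mul_sub_sq (c : ℝ) :
    HasSum (fun j : ℕ => c ^ j / j ! * (j - c) ^ 2) (c * Real.exp c) := by
  have := ((hasSum_pow_div_factorial_mul_descending c).add
    ((hasSum_pow_div_factorial_mul_natCast c).mul_left (1 - 2 * c))).add
    ((hasSum_pow_div_factorial c).mul_left (c ^ 2))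
  rw [show c * Real.exp c = c ^ 2 * Real.exp c + (1 - 2 * c) * (c * Real.exp c)
    + c ^ 2 * Real.exp c by ring]
  refine this.congr_fun fun j => ?_
  ring

-- With i = j + 2 the square is (i - c - 2)², of Poisson mean c + 4; the terms i = 0, 1 are dropped.
-- The shifted factorial absorbs a weight of order 1/(j+1)².
open Nat in
theorem hasSum_pow_div_factorial_add_two_mul_sub_sq_le {c : ℝ} (hc : 0 ≤ c) :
    Summable (fun j : ℕ => c ^ (j + 2) / (j + 2)! * (j - c) ^ 2) ∧
      ∑' j : ℕ, c ^ (j + 2) / (j + 2)! * (j - c) ^ 2 ≤ (c + 4) * Real.exp c := by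
  have h : HasSum (fun j : ℕ => c ^ j / j ! * (j - 2 - c) ^ 2) ((c + 4) * Real.exp c) := by
    have := ((hasSum_pow_div_factorial_mul_sub_sq c).add
      ((hasSum_pow_div_factorial_mul_sub c).mul_left (-4))).add
      ((hasSum_pow_div_factorial c).mul_left 4)
    rw [show (c + 4) * Real.exp c = c * Real.exp c + -4 * 0 + 4 * Real.exp c by ring]
    refine this.congr_fun fun j => ?_
    ring
  have h2 := (hasSum_nat_add_iff' 2).2 h
  have e : (fun j : ℕ => c ^ (j + 2) / (j + 2)! * (j - c) ^ 2) =
      fun j : ℕ => c ^ (j + 2) / (j + 2)! * (((j + 2 : ℕ) : ℝ) - 2 - c) ^ 2 := by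
    funext j; push_cast; ring
  rw [e]
  refine ⟨h2.summable, h2.tsum_eq.trans_le (sub_le_self _ (Finset.sum_nonneg fun j _ => ?_))⟩
  positivity

variable {A : Type*} [NormedRing A] [NormOneClass A] {T : A}

theorem norm_mul_pow_add_le (hT : ‖T‖ ≤ 1) {B : A} {K : ℝ} {m : ℕ} (h : ‖B * T ^ m‖ ≤ K)
    (i : ℕ) : ‖B * T ^ (m + i)‖ ≤ K := by
  rw [pow_add, ← mul_assoc]
  refine (norm_mul_le _ _).trans ((mul_le_of_le_one_right (norm_nonneg _) ?_).trans h)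
  exact (norm_pow_le _ _).trans (pow_le_one₀ (norm_nonneg _) hT)

variable [NormedAlgebra ℝ A]

/-- Discrete Taylor formula: second differences are summed twice. The hypothesis is needed only at
the lowest exponent, since multiplying by further powers of `T` does not increase the norm. -/
theorem norm_pow_add_sub_taylor_le (hT : ‖T‖ ≤ 1) {K : ℝ} {m : ℕ}
    (h : ‖(T - 1) ^ 2 * T ^ m‖ ≤ K) (N : ℕ) :
    ‖T ^ (m + N) - T ^ m - (N : ℝ) • ((T - 1) * T ^ m)‖ ≤ K * N ^ 2 := by
  have hK : 0 ≤ K := (norm_nonneg _).trans h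
  have h1 : ∀ N : ℕ, ‖(T - 1) * (T ^ (m + N) - T ^ m)‖ ≤ K * N := by
    intro N
    induction N with
    | zero => simp
    | succ N ih =>
      have e : (T - 1) * (T ^ (m + (N + 1)) - T ^ m) =
          (T - 1) * (T ^ (m + N) - T ^ m) + (T - 1) ^ 2 * T ^ (m + N) := by
        rw [← add_assoc, pow_succ' T]; noncomm_ring
      rw [e]
      refine (norm_add_le _ _).trans ?_
      push_cast
      linarith [norm_mul_pow_add_le hT h N]
  induction N with
  | zero => simp
  | succ N ih =>
    have e : T ^ (m + (N + 1)) - T ^ m - ((N + 1 : ℕ) : ℝ) • ((T - 1) * T ^ m) =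
        (T ^ (m + N) - T ^ m - (N : ℝ) • ((T - 1) * T ^ m))
          + (T - 1) * (T ^ (m + N) - T ^ m) := by
      rw [← add_assoc, pow_succ' T, Nat.cast_succ, add_smul, one_smul]; noncomm_ring
    rw [e]
    refine (norm_add_le _ _).trans ((add_le_add ih (h1 N)).trans ?_)
    push_cast
    nlinarith [mul_nonneg hK (Nat.cast_nonneg (α := ℝ) N)]

theorem norm_pow_sub_taylor_add_le (hT : ‖T‖ ≤ 1) {K : ℝ} {m : ℕ}
    (h : ‖(T - 1) ^ 2 * T ^ m‖ ≤ K) (N : ℕ) :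
    ‖T ^ m - T ^ (m + N) + (N : ℝ) • ((T - 1) * T ^ (m + N))‖ ≤ K * N ^ 2 := by
  have hK : 0 ≤ K := (norm_nonneg _).trans h
  induction N with
  | zero => simp
  | succ N ih =>
    have e : T ^ m - T ^ (m + (N + 1)) + ((N + 1 : ℕ) : ℝ) • ((T - 1) * T ^ (m + (N + 1))) =
        (T ^ m - T ^ (m + N) + (N : ℝ) • ((T - 1) * T ^ (m + N)))
          + ((N : ℝ) + 1) • ((T - 1) ^ 2 * T ^ (m + N)) := by
      have e1 : (T - 1) * (T * T ^ (m + N)) = (T - 1) ^ 2 * T ^ (m + N) + (T - 1) * T ^ (m + N) := by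
        noncomm_ring
      have e2 : T * T ^ (m + N) = (T - 1) * T ^ (m + N) + T ^ (m + N) := by noncomm_ring
      rw [← add_assoc, pow_succ' T, e1, e2, Nat.cast_succ]
      module
    have h2 : ‖((N : ℝ) + 1) • ((T - 1) ^ 2 * T ^ (m + N))‖ ≤ (N + 1) * K := by
      rw [norm_smul, Real.norm_of_nonneg (by positivity)]
      exact mul_le_mul_of_nonneg_left (norm_mul_pow_add_le hT h N) (by positivity)
    rw [e]
    refine (norm_add_le _ _).trans ((add_le_add ih h2).trans ?_)
    push_cast
    nlinarith [mul_nonneg hK (Nat.cast_nonneg (α := ℝ) N)]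

/-- The remainder is controlled at the smaller of j and n; adding both bounds avoids a case
distinction in the Poisson sum. -/
theorem norm_pow_sub_pow_sub_smul_le (hT : ‖T‖ ≤ 1) {K : ℝ} {n : ℕ}
    (h : ∀ m ≤ n, ‖(T - 1) ^ 2 * T ^ m‖ ≤ K / (m + 1) ^ 2) (j : ℕ) :
    ‖T ^ j - T ^ n - ((j : ℝ) - n) • ((T - 1) * T ^ n)‖ ≤
      K * ((j - n) ^ 2 / (j + 1) ^ 2 + (j - n) ^ 2 / (n + 1) ^ 2) := by
  have hK : 0 ≤ K := by
    have := (norm_nonneg _).trans (h 0 (Nat.zero_le n))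
    simpa using this
  rcases le_total n j with hj | hj
  · obtain ⟨N, rfl⟩ := Nat.exists_eq_add_of_le hj
    have := norm_pow_add_sub_taylor_le hT (h n le_rfl) N
    rw [Nat.cast_add, add_sub_cancel_left]
    refine this.trans ?_
    rw [div_mul_eq_mul_div, ← mul_div_assoc', mul_add]
    exact le_add_of_nonneg_left (by positivity)
  · obtain ⟨N, rfl⟩ := Nat.exists_eq_add_of_le hj
    have := norm_pow_sub_taylor_add_le hT (h j hj) N
    rw [Nat.cast_add, sub_add_cancel_left, neg_smul, sub_neg_eq_add, neg_sq]
    refine this.trans ?_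
    rw [div_mul_eq_mul_div, ← mul_div_assoc', mul_add]
    exact le_add_of_nonneg_right (by positivity)

open Nat in
theorem norm_exp_smul_sub_one_sub_pow_le [CompleteSpace A] (hT : ‖T‖ ≤ 1) {K : ℝ} {n : ℕ}
    (hn : 1 ≤ n) (h : ∀ m ≤ n, ‖(T - 1) ^ 2 * T ^ m‖ ≤ K / (m + 1) ^ 2) :
    ‖NormedSpace.exp ((n : ℝ) • (T - 1)) - T ^ n‖ ≤ 11 * K / n := by
  have hK : 0 ≤ K := by
    have := (norm_nonneg _).trans (h 0 (Nat.zero_le n))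
    simpa using this
  have hn0 : (1 : ℝ) ≤ n := by exact_mod_cast hn
  have hnpos : (0 : ℝ) < n := by linarith
  have hexp : HasSum (fun j : ℕ => ((n : ℝ) ^ j / j !) • T ^ j)
      (NormedSpace.exp ((n : ℝ) • T)) := by
    refine (NormedSpace.exp_series_hasSum_exp' (𝕂 := ℝ) ((n : ℝ) • T)).congr_fun fun j => ?_
    rw [smul_pow, smul_smul, div_eq_inv_mul]
  -- The linear Taylor term disappears because the Poisson variable has mean n.
  have hsum : HasSum (fun j : ℕ => ((n : ℝ) ^ j / j !) •
      (T ^ j - T ^ n - ((j : ℝ) - n) • ((T - 1) * T ^ n)))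
      (NormedSpace.exp ((n : ℝ) • T) - Real.exp n • T ^ n) := by
    have := (hexp.sub ((hasSum_pow_div_factorial (n : ℝ)).smul_const (T ^ n))).sub
      ((hasSum_pow_div_factorial_mul_sub (n : ℝ)).smul_const ((T - 1) * T ^ n))
    rw [zero_smul, sub_zero] at this
    refine this.congr_fun fun j => ?_
    rw [smul_sub, smul_sub, smul_smul]
  obtain ⟨hs, hle⟩ := hasSum_pow_div_factorial_add_two_mul_sub_sq_le hnpos.le
  have hbound := ((hs.hasSum.mul_left (2 / (n : ℝ) ^ 2)).add
    ((hasSum_pow_div_factorial_mul_sub_sq (n : ℝ)).mul_left (1 / ((n : ℝ) + 1) ^ 2))).mul_left K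
  have hmain := hsum.norm_le_of_bounded hbound fun j => by
    rw [norm_smul, Real.norm_of_nonneg (by positivity)]
    refine (mul_le_mul_of_nonneg_left (norm_pow_sub_pow_sub_smul_le hT h j)
      (by positivity)).trans ?_
    rw [mul_left_comm]
    refine mul_le_mul_of_nonneg_left ?_ hK
    rw [mul_add]
    refine add_le_add ?_ (le_of_eq (by ring))
    -- The bound 1/(j+1)² ≤ 2/((j+1)(j+2)) turns j! into (j+2)!.
    have e : 2 / (n : ℝ) ^ 2 * ((n : ℝ) ^ (j + 2) / (j + 2)! * (j - n) ^ 2) =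
        (n : ℝ) ^ j / j ! * ((j - n) ^ 2 * (2 / ((j + 1) * (j + 2)))) := by
      rw [Nat.factorial_succ, Nat.factorial_succ, pow_add]
      push_cast
      field_simp
      ring
    rw [e, div_eq_mul_inv (((j : ℝ) - n) ^ 2)]
    refine mul_le_mul_of_nonneg_left (mul_le_mul_of_nonneg_left ?_ (sq_nonneg _)) (by positivity)
    rw [inv_eq_one_div, div_le_div_iff₀ (by positivity) (by positivity)]
    nlinarith [Nat.cast_nonneg (α := ℝ) j]
  have hfinal : ‖NormedSpace.exp ((n : ℝ) • T) - Real.exp n • T ^ n‖ ≤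
      Real.exp n * (11 * K / n) := by
    refine hmain.trans ?_
    -- Since n ≥ 1, n + 4 ≤ 5n gives 10; the other half of the remainder gives 1, whence 11.
    have h1 : 2 / (n : ℝ) ^ 2 * ((n + 4) * Real.exp n) ≤ Real.exp n * (10 / n) := by
      rw [show 2 / (n : ℝ) ^ 2 * ((n + 4) * Real.exp n) =
        Real.exp n * (2 * (n + 4) / n ^ 2) by ring]
      refine mul_le_mul_of_nonneg_left ?_ (Real.exp_pos _).le
      rw [div_le_div_iff₀ (by positivity) hnpos]
      nlinarith
    have h2 : 1 / ((n : ℝ) + 1) ^ 2 * (n * Real.exp n) ≤ Real.exp n * (1 / n) := by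
      rw [show 1 / ((n : ℝ) + 1) ^ 2 * (n * Real.exp n) =
        Real.exp n * (n / (n + 1) ^ 2) by ring]
      refine mul_le_mul_of_nonneg_left ?_ (Real.exp_pos _).le
      rw [div_le_div_iff₀ (by positivity) hnpos]
      nlinarith
    have h3 := mul_le_mul_of_nonneg_left hle (show 0 ≤ 2 / (n : ℝ) ^ 2 by positivity)
    calc _ ≤ K * (Real.exp n * (10 / n) + Real.exp n * (1 / n)) :=
          mul_le_mul_of_nonneg_left (add_le_add (h3.trans h1) h2) hK
      _ = _ := by ring
  have hexp2 : NormedSpace.exp ((n : ℝ) • (T - 1)) - T ^ n =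
      Real.exp (-n) • (NormedSpace.exp ((n : ℝ) • T) - Real.exp n • T ^ n) := by
    have e : (n : ℝ) • (T - 1) = algebraMap ℝ A (-n) + (n : ℝ) • T := by
      rw [Algebra.algebraMap_eq_smul_one]; module
    rw [e, NormedSpace.exp_add_of_commute_of_mem_ball (𝕂 := ℝ) (Algebra.commutes _ _)
      ((NormedSpace.expSeries_radius_eq_top ℝ A).symm ▸ edist_lt_top _ _)
      ((NormedSpace.expSeries_radius_eq_top ℝ A).symm ▸ edist_lt_top _ _),
      ← NormedSpace.algebraMap_exp_comm, ← Algebra.smul_def, smul_sub, smul_smul,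
      ← Real.exp_eq_exp_ℝ, ← Real.exp_add, neg_add_cancel, Real.exp_zero, one_smul]
  rw [hexp2, norm_smul, Real.norm_of_nonneg (Real.exp_pos _).le, Real.exp_neg,
    inv_mul_le_iff₀ (Real.exp_pos _)]
  exact hfinal

end PoissonMixture

/-! ### Lattice measures as operators on bounded functions -/

namespace CompoundPoisson

variable {d : ℕ}

theorem latticePoint_injective : Function.Injective (latticePoint (d := d)) := by
  intro x y h
  funext i
  have := congrArg (fun z : EuclideanSpace ℝ (Fin d) => z i) h
  simpa [latticePoint] using this

theorem latticePoint_zero : latticePoint (0 : Fin d → ℤ) = 0 := by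
  ext i; simp [latticePoint]

theorem latticePoint_add (x y : Fin d → ℤ) :
    latticePoint (x + y) = latticePoint x + latticePoint y := by
  ext i; simp [latticePoint]

theorem latticePoint_neg (x : Fin d → ℤ) : latticePoint (-x) = -latticePoint x := by
  ext i; simp [latticePoint]

theorem hasSum_integral_of_lattice {μ : Measure (EuclideanSpace ℝ (Fin d))}
    (hμ : μ (Set.range latticePoint)ᶜ = 0) {f : EuclideanSpace ℝ (Fin d) → ℝ}
    (hf : Integrable f μ) :
    HasSum (fun x => μ.real {latticePoint x} * f (latticePoint x)) (∫ z, f z ∂μ) := by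
  have hU : (⋃ x : Fin d → ℤ, {latticePoint x}) = Set.range (latticePoint (d := d)) := by
    ext z; simp [eq_comm]
  have h := hasSum_integral_iUnion (μ := μ) (f := f) (s := fun x : Fin d → ℤ => {latticePoint x})
    (fun x => measurableSet_singleton _)
    (fun x y hxy => Set.disjoint_singleton.2 fun h => hxy (latticePoint_injective h))
    hf.integrableOn
  have hr : μ.restrict (Set.range latticePoint) = μ :=
    Measure.restrict_eq_self_of_ae_mem (by rw [ae_iff]; exact hμ)
  rw [hU, hr] at h
  simpa only [integral_singleton, smul_eq_mul] using h

theorem hasSum_real_lattice {μ : Measure (EuclideanSpace ℝ (Fin d))} [IsProbabilityMeasure μ]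
    (hμ : μ (Set.range latticePoint)ᶜ = 0) :
    HasSum (fun x => μ.real {latticePoint x}) 1 := by
  simpa using hasSum_integral_of_lattice hμ (integrable_const (1 : ℝ))

open BoundedContinuousFunction in
/-- Bounded functions on the lattice `ℤ^d`, with the supremum norm. -/
def LatticeFun (d : ℕ) : Type := (Fin d → ℤ) →ᵇ ℝ

namespace LatticeFun

open BoundedContinuousFunction

noncomputable instance : NormedAddCommGroup (LatticeFun d) :=
  inferInstanceAs (NormedAddCommGroup ((Fin d → ℤ) →ᵇ ℝ))

noncomputable instance : NormedSpace ℝ (LatticeFun d) :=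
  inferInstanceAs (NormedSpace ℝ ((Fin d → ℤ) →ᵇ ℝ))

instance : CompleteSpace (LatticeFun d) :=
  inferInstanceAs (CompleteSpace ((Fin d → ℤ) →ᵇ ℝ))

instance : Nontrivial (LatticeFun d) := by
  refine ⟨⟨(BoundedContinuousFunction.const _ 1 : (Fin d → ℤ) →ᵇ ℝ),
    (BoundedContinuousFunction.const _ 0 : (Fin d → ℤ) →ᵇ ℝ), fun h => ?_⟩⟩
  exact one_ne_zero (DFunLike.congr_fun (F := (Fin d → ℤ) →ᵇ ℝ) h 0)

/-- Evaluation at a lattice point. -/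
noncomputable def eval (x : Fin d → ℤ) : LatticeFun d →L[ℝ] ℝ := evalCLM ℝ x

theorem ext_eval {f g : LatticeFun d} (h : ∀ x, eval x f = eval x g) : f = g :=
  BoundedContinuousFunction.ext h

theorem norm_eval_le (f : LatticeFun d) (x : Fin d → ℤ) : ‖eval x f‖ ≤ ‖f‖ :=
  BoundedContinuousFunction.norm_coe_le_norm _ x

theorem norm_le_of_eval {f : LatticeFun d} {c : ℝ} (hc : 0 ≤ c) (h : ∀ x, ‖eval x f‖ ≤ c) :
    ‖f‖ ≤ c :=
  (BoundedContinuousFunction.norm_le hc).2 h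

/-- Translation by `x`. -/
noncomputable def shift (x : Fin d → ℤ) : LatticeFun d →L[ℝ] LatticeFun d :=
  LinearMap.mkContinuous
    { toFun := fun f => BoundedContinuousFunction.compContinuous (α := Fin d → ℤ) (β := ℝ) f
        ⟨fun y => y + x, continuous_of_discreteTopology⟩
      map_add' := fun _ _ => rfl
      map_smul' := fun _ _ => rfl } 1 fun f => by
    rw [one_mul]
    exact norm_le_of_eval (norm_nonneg f) fun y => norm_eval_le f (y + x)

@[simp]
theorem eval_shift (x y : Fin d → ℤ) (f : LatticeFun d) :
    eval y (shift x f) = eval (y + x) f := rfl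

theorem norm_shift_le (x : Fin d → ℤ) : ‖shift x‖ ≤ 1 :=
  LinearMap.mkContinuous_norm_le _ zero_le_one _

theorem shift_zero : shift (0 : Fin d → ℤ) = 1 :=
  ContinuousLinearMap.ext fun f => ext_eval fun y => by simp

theorem shift_add (x y : Fin d → ℤ) : shift (x + y) = shift x * shift y :=
  ContinuousLinearMap.ext fun f => ext_eval fun z => by simp [add_assoc]

/-- The restriction to the lattice of the indicator of a set in `ℝ^d`. -/
noncomputable def indicator (B : Set (EuclideanSpace ℝ (Fin d))) : LatticeFun d :=
  BoundedContinuousFunction.indicator (latticePoint ⁻¹' B) (isClopen_discrete _)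

open Classical in
theorem eval_indicator (B : Set (EuclideanSpace ℝ (Fin d))) (x : Fin d → ℤ) :
    eval x (indicator B) = if latticePoint x ∈ B then 1 else 0 :=
  (Set.indicator_apply _ _ _)

theorem norm_indicator_le (B : Set (EuclideanSpace ℝ (Fin d))) : ‖indicator B‖ ≤ 1 := by
  refine norm_le_of_eval zero_le_one fun x => ?_
  rw [eval_indicator]
  split_ifs <;> simp

end LatticeFun

open LatticeFun

/-- Convolution with a finite measure, acting on bounded functions on the lattice. -/
noncomputable def latticeOp (μ : Measure (EuclideanSpace ℝ (Fin d))) :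
    LatticeFun d →L[ℝ] LatticeFun d :=
  ∑' x, μ.real {latticePoint x} • shift x

theorem hasSum_latticeOp {μ : Measure (EuclideanSpace ℝ (Fin d))} [IsProbabilityMeasure μ]
    (hμ : μ (Set.range latticePoint)ᶜ = 0) :
    HasSum (fun x => μ.real {latticePoint x} • shift x) (latticeOp μ) := by
  refine Summable.hasSum (Summable.of_norm_bounded (hasSum_real_lattice hμ).summable fun x => ?_)
  rw [norm_smul, Real.norm_of_nonneg measureReal_nonneg]
  exact mul_le_of_le_one_right measureReal_nonneg (norm_shift_le x)

/-- The operator `a` on bounded functions computes the values of the signed measure `M`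
on all translates of sets by lattice points. -/
def Represents (M : SignedMeasure (EuclideanSpace ℝ (Fin d)))
    (a : LatticeFun d →L[ℝ] LatticeFun d) : Prop :=
  ∀ B, MeasurableSet B → ∀ y,
    M ((fun z => z + latticePoint y) ⁻¹' B) = eval y (a (LatticeFun.indicator B))

theorem represents_unitMass : Represents (unitMass (EuclideanSpace ℝ (Fin d))) 1 := by
  intro B hB y
  have hm : MeasurableSet ((fun z => z + latticePoint y) ⁻¹' B) := (measurable_add_const _) hB
  rw [unitMass, Measure.toSignedMeasure_apply_measurable hm, measureReal_def,
    Measure.dirac_apply' _ hm, one_apply_eq_self, eval_indicator]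
  by_cases hy : latticePoint y ∈ B <;> simp [hy]

/-! ### Convolution of signed measures as an integral -/

section Convolution

variable {E : Type*} [AddCommMonoid E] [MeasurableSpace E] [MeasurableAdd₂ E]

/-- Commutativity puts the second factor in the outer position, so that convolution with μ becomes
an integral against μ. -/
theorem conv_eq_map_swap (M V : SignedMeasure E) :
    conv M V = (VectorMeasure.prod V M (ContinuousLinearMap.mul ℝ ℝ)).map
      (fun x : E × E => x.1 + x.2) := by
  have := isFiniteMeasure_variation V
  have h : VectorMeasure.prod M V (ContinuousLinearMap.mul ℝ ℝ) =
      (VectorMeasure.prod V M (ContinuousLinearMap.mul ℝ ℝ)).map Prod.swap := by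
    refine VectorMeasure.prod_eq_of_forall_apply_prod fun s t hs ht => ?_
    rw [VectorMeasure.map_apply _ measurable_swap (hs.prod ht), Set.preimage_swap_prod,
      VectorMeasure.prod_apply]
    simp [mul_comm]
  ext s hs
  rw [conv, h, VectorMeasure.map_apply _ measurable_add hs,
    VectorMeasure.map_apply _ measurable_swap (measurable_add hs),
    VectorMeasure.map_apply _ measurable_add hs, ← Set.preimage_comp]
  congr 2
  funext x
  exact add_comm _ _

theorem conv_toSignedMeasure_apply (M : SignedMeasure E) (μ : Measure E) [IsFiniteMeasure μ]
    {B : Set E} (hB : MeasurableSet B) :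
    conv M μ.toSignedMeasure B = ∫ x, M ((fun z => x + z) ⁻¹' B) ∂μ := by
  have := isFiniteMeasure_variation μ.toSignedMeasure
  rw [conv_eq_map_swap, VectorMeasure.map_apply _ measurable_add hB,
    VectorMeasure.prod_apply_eq_integral (measurable_add hB)]
  have := VectorMeasure.integral_toSignedMeasure (μ := μ)
    (f := fun x => M ((fun z => x + z) ⁻¹' B))
  rw [← this]
  congr 1

theorem conv_smul_sub (M V W : SignedMeasure E) (c : ℝ) :
    conv M (c • (V - W)) = c • (conv M V - conv M W) := by
  have := isFiniteMeasure_variation M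
  have h : VectorMeasure.prod M (c • (V - W)) (ContinuousLinearMap.mul ℝ ℝ) =
      c • (VectorMeasure.prod M V (ContinuousLinearMap.mul ℝ ℝ)
        - VectorMeasure.prod M W (ContinuousLinearMap.mul ℝ ℝ)) := by
    refine VectorMeasure.prod_eq_of_forall_apply_prod fun s t hs ht => ?_
    simp [VectorMeasure.prod_apply]
    ring
  ext s hs
  rw [conv, h, VectorMeasure.map_apply _ measurable_add hs]
  simp [conv, VectorMeasure.map_apply _ measurable_add hs]

theorem integrable_apply_preimage_add (M : SignedMeasure E) (μ : Measure E) [IsFiniteMeasure μ]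
    {B : Set E} (hB : MeasurableSet B) :
    Integrable (fun x => M ((fun z => x + z) ⁻¹' B)) μ :=
  Integrable.of_bound
    (VectorMeasure.stronglyMeasurable_vectorMeasure_prodMk_left
      (measurable_add hB)).aestronglyMeasurable M.bound
    (Filter.Eventually.of_forall fun _ => VectorMeasure.norm_apply_le_bound)

end Convolution

/-- Convolving with μ averages the values of M over lattice translates of the set, which
`Represents` records for every y; this is what makes induction on powers possible. -/
theorem Represents.conv_toSignedMeasure {M : SignedMeasure (EuclideanSpace ℝ (Fin d))}
    {a : LatticeFun d →L[ℝ] LatticeFun d} (h : Represents M a)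
    {μ : Measure (EuclideanSpace ℝ (Fin d))} [IsProbabilityMeasure μ]
    (hμ : μ (Set.range latticePoint)ᶜ = 0) :
    Represents (conv M μ.toSignedMeasure) (latticeOp μ * a) := by
  intro B hB y
  have hm : MeasurableSet ((fun z => z + latticePoint y) ⁻¹' B) := (measurable_add_const _) hB
  rw [conv_toSignedMeasure_apply _ _ hm]
  have h1 := hasSum_integral_of_lattice hμ (integrable_apply_preimage_add M μ hm)
  have h2 : HasSum (fun x => μ.real {latticePoint x} * eval (y + x) (a (LatticeFun.indicator B)))
      (eval y ((latticeOp μ * a) (LatticeFun.indicator B))) := by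
    have := ((hasSum_latticeOp hμ).mapL
      (ContinuousLinearMap.apply ℝ (LatticeFun d) (a (LatticeFun.indicator B)))).mapL
      (eval y)
    simpa using this
  refine (h1.congr_fun fun x => ?_).unique h2 |>.symm ▸ rfl
  rw [← h B hB, latticePoint_add]
  congr 2
  ext z
  simp only [Set.mem_preimage]
  rw [add_comm (latticePoint x) z, add_assoc, add_comm (latticePoint x)]

theorem Represents.smul_sub {M N : SignedMeasure (EuclideanSpace ℝ (Fin d))}
    {a b : LatticeFun d →L[ℝ] LatticeFun d} (hM : Represents M a)
    (hN : Represents N b) (c : ℝ) : Represents (c • (M - N)) (c • (a - b)) := by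
  intro B hB y
  simp [hM B hB y, hN B hB y]

theorem latticeOp_dirac_zero : latticeOp (Measure.dirac (0 : EuclideanSpace ℝ (Fin d))) = 1 := by
  rw [latticeOp, tsum_eq_single 0 fun x hx => ?_]
  · simp [latticePoint_zero, shift_zero, measureReal_def]
  · have : latticePoint x ≠ 0 := fun h => hx (latticePoint_injective (h.trans latticePoint_zero.symm))
    simp [measureReal_def, this.symm]

theorem represents_convPow {μ : Measure (EuclideanSpace ℝ (Fin d))} [IsProbabilityMeasure μ]
    (hμ : μ (Set.range latticePoint)ᶜ = 0) (n : ℕ) :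
    Represents (convPow μ.toSignedMeasure n) (latticeOp μ ^ n) := by
  induction n with
  | zero => exact represents_unitMass
  | succ n ih =>
    rw [pow_succ']
    exact ih.conv_toSignedMeasure hμ

theorem represents_convPow_smul_sub {μ : Measure (EuclideanSpace ℝ (Fin d))}
    [IsProbabilityMeasure μ] (hμ : μ (Set.range latticePoint)ᶜ = 0) (c : ℝ) (j : ℕ) :
    Represents (convPow (c • (μ.toSignedMeasure - unitMass (EuclideanSpace ℝ (Fin d)))) j)
      ((c • (latticeOp μ - 1)) ^ j) := by
  induction j with
  | zero => exact represents_unitMass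
  | succ j ih =>
    rw [pow_succ', convPow, conv_smul_sub, smul_mul_assoc, sub_mul]
    refine (ih.conv_toSignedMeasure hμ).smul_sub ?_ c
    -- The unit mass is itself a lattice probability measure, with operator 1.
    have h := ih.conv_toSignedMeasure (μ := Measure.dirac (0 : EuclideanSpace ℝ (Fin d)))
      (by rw [Measure.dirac_apply]; simp [← latticePoint_zero])
    rwa [latticeOp_dirac_zero] at h

theorem represents_convExp {μ : Measure (EuclideanSpace ℝ (Fin d))} [IsProbabilityMeasure μ]
    (hμ : μ (Set.range latticePoint)ᶜ = 0) (c : ℝ) :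
    Represents (convExp (c • (μ.toSignedMeasure - unitMass (EuclideanSpace ℝ (Fin d)))))
      (NormedSpace.exp (c • (latticeOp μ - 1))) := by
  intro B hB y
  have h := ((NormedSpace.exp_series_hasSum_exp' (𝕂 := ℝ) (c • (latticeOp μ - 1))).mapL
    (ContinuousLinearMap.apply ℝ (LatticeFun d) (LatticeFun.indicator B))).mapL (eval y)
  refine Eq.trans (tsum_congr fun j => ?_) h.tsum_eq
  rw [represents_convPow_smul_sub hμ c j B hB y]
  simp [div_eq_inv_mul]

/-- Values on B are evaluations at 0 of the operators applied to the indicator of B, whose norm is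
at most 1. -/
theorem tvDist_le_of_represents {M N : SignedMeasure (EuclideanSpace ℝ (Fin d))}
    {a b : LatticeFun d →L[ℝ] LatticeFun d} (hM : Represents M a)
    (hN : Represents N b) : tvDist M N ≤ ‖a - b‖ := by
  refine csSup_le ⟨_, ∅, MeasurableSet.empty, rfl⟩ ?_
  rintro r ⟨B, hB, rfl⟩
  have h1 := hM B hB 0
  have h2 := hN B hB 0
  simp only [latticePoint_zero, add_zero, Set.preimage_id'] at h1 h2
  rw [h1, h2, ← Real.norm_eq_abs]
  calc ‖eval 0 (a (LatticeFun.indicator B)) - eval 0 (b (LatticeFun.indicator B))‖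
      = ‖eval 0 ((a - b) (LatticeFun.indicator B))‖ := by rw [sub_apply, map_sub]
    _ ≤ ‖(a - b) (LatticeFun.indicator B)‖ := norm_eval_le _ _
    _ ≤ ‖a - b‖ * ‖LatticeFun.indicator B‖ := (a - b).le_opNorm _
    _ ≤ ‖a - b‖ := mul_le_of_le_one_right (norm_nonneg _) (norm_indicator_le B)

end CompoundPoisson

/-! ### The compound Poisson bound -/

theorem mainTheorem8 :
    ∃ C : ℝ, 0 < C ∧
      ∀ (d : ℕ) (F : Measure (EuclideanSpace ℝ (Fin d)))
        [IsProbabilityMeasure F] (q : ℝ),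
        F.IsNegInvariant →
        F.support ⊆ Set.range (latticePoint (d := d)) →
        q = F.real {0} → 0 < q → q < 1 →
        ∀ n : ℕ, 1 ≤ n →
          tvDist (convPow F.toSignedMeasure n)
              (convExp ((n : ℝ) • (F.toSignedMeasure - unitMass (EuclideanSpace ℝ (Fin d)))))
            ≤ C * (1 + delta F n ^ 2) / (n * q ^ (7 / 2 : ℝ)) := by
  -- 176 = 11 · 16: the Poisson expansion constant times the squared-difference constant.
  refine ⟨176, by norm_num, fun d F _ q hF hsupp hq hq0 hq1 n hn => ?_⟩
  have hn0 : (1 : ℝ) ≤ n := by exact_mod_cast hn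
  have hlat : F (Set.range (latticePoint (d := d)))ᶜ = 0 :=
    measure_mono_null (Set.compl_subset_compl.2 hsupp) Measure.measure_compl_support
  have hp0 : F.real {latticePoint (0 : Fin d → ℤ)} = q := by rw [hq, latticePoint_zero]
  have hsymm : ∀ x : Fin d → ℤ, F.real {latticePoint (-x)} = F.real {latticePoint x} := fun x => by
    rw [latticePoint_neg, ← Set.neg_singleton, measureReal_def, Measure.measure_neg,
      ← measureReal_def]
  have he : (2 : ℝ) ≤ Real.exp 1 := by
    have := Real.add_one_le_exp (1 : ℝ)
    linarith
  have hT : ‖latticeOp F‖ ≤ 1 := norm_le_of_hasSum_smul LatticeFun.norm_shift_le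
    (fun _ => measureReal_nonneg) (hasSum_real_lattice hlat) (hasSum_latticeOp hlat)
  have hsq : ∀ m ≤ n, ‖(latticeOp F - 1) ^ 2 * latticeOp F ^ m‖ ≤
      16 * delta F n ^ 2 / q ^ 2 / (m + 1) ^ 2 := by
    intro m hm
    -- The factor e in δ gives room for the case m = n: n + 1 ≤ 2n ≤ ne.
    have hm' : (m : ℝ) + 1 ≤ n * Real.exp 1 := by
      have : (m : ℝ) ≤ n := by exact_mod_cast hm
      nlinarith
    have := norm_sub_one_sq_mul_pow_le (e := LatticeFun.shift) (p := fun x => F.real {latticePoint x})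
      LatticeFun.shift_zero LatticeFun.shift_add LatticeFun.norm_shift_le (fun _ => measureReal_nonneg)
      (hasSum_real_lattice hlat) hsymm (by rwa [hp0]) (hasSum_latticeOp hlat) hm'
    rwa [hp0] at this
  have hmain := norm_exp_smul_sub_one_sub_pow_le hT hn hsq
  rw [norm_sub_rev] at hmain
  refine (tvDist_le_of_represents (represents_convPow hlat n)
    (represents_convExp hlat n)).trans (hmain.trans ?_)
  have hq2 : q ^ (7 / 2 : ℝ) ≤ q ^ 2 := by
    rw [← Real.rpow_natCast q 2]
    exact Real.rpow_le_rpow_of_exponent_ge hq0 hq1.le (by norm_num)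
  have hq7 : 0 < q ^ (7 / 2 : ℝ) := Real.rpow_pos_of_pos hq0 _
  rw [show 11 * (16 * delta F n ^ 2 / q ^ 2) / n = 176 * delta F n ^ 2 / (n * q ^ 2) by
    field_simp; ring]
  gcongr
  linarith
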